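/- Let $G=(V,E)$ be a finite simple graph. A pair $(A,B)$ of proper subsets of $V$ is a separation of $G$ if $A\cup B=V$ and there are no edges of $G$ between $A\setminus B$ and $B\setminus A$. For a function $f:\mathbb{Z}^+\to\mathbb{R}$, the graph $G$ is called $f$-connected if $|A\cap B|\ge f(|A\setminus B|)$ for every separation $(A,B)$ of $G$ with $|A\setminus B|\le|B\setminus A|$. Theorem. There exist an absolute constant $C$ and an integer $n_0$ such that, for every function $f:\mathbb{Z}^+\to\mathbb{R}$ with $f(k)\ge k\log k+C$ for all $k\ge 1$ (in particular for $f(k)=k\log k+C$; $\log$ is the natural logarithm), every $f$-connected graph $G$ on $n\ge n_0$ vertices is Hamiltonian. -/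

import Mathlib

namespace SimpleGraph

/-- A pair `(A, B)` of proper subsets of the vertex set is a separation of `G` if `A ∪ B = V` and
there is no edge of `G` between `A \ B` and `B \ A`. -/
def IsVertexSeparation {V : Type*} [Fintype V] [DecidableEq V] (G : SimpleGraph V)
    (A B : Finset V) : Prop :=
  A ≠ Finset.univ ∧ B ≠ Finset.univ ∧ A ∪ B = Finset.univ ∧
    ∀ a ∈ A \ B, ∀ b ∈ B \ A, ¬ G.Adj a b

/-- `G` is `f`-connected if `|A ∩ B| ≥ f (|A \ B|)` for every separation `(A, B)` of `G` with
`|A \ B| ≤ |B \ A|`. Since both sides of a separation are proper subsets covering `V`, the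
number `|A \ B|` is always positive, so the value `f 0` plays no role. -/
def IsFunConnected {V : Type*} [Fintype V] [DecidableEq V] (G : SimpleGraph V)
    (f : ℕ → ℝ) : Prop :=
  ∀ A B : Finset V, G.IsVertexSeparation A B → (A \ B).card ≤ (B \ A).card →
    f (A \ B).card ≤ ((A ∩ B).card : ℝ)

end SimpleGraph

/-! Choose a large constant `E`, `m` about 2n / log n and `T` about log n / log `E`. A separation
bound of order k log k makes any two disjoint `m`-sets joined by an edge, since m log m ≥ n, and
makes every set of at most 4m vertices expand by a factor 4E. Hamiltonicity then follows from Pósa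
rotations of a longest path.

Expansion gives more than 4m possible end vertices within `T` rotations (`pow_le_card_rotEnds`). Cut
the path into 4(T+1) disjoint blocks of length 7m+2. A vertex is trapped by a block if rotations
inside that block may be confined to fewer than `m` ends; joinedness leaves fewer than `m` trapped
vertices per block (`card_trapped_lt`). Hence at most 4m vertices are trapped by more than `T`
blocks, and at most `T` rotations at each end produce a longest path whose two ends are each trapped
by at most `T` blocks.

The 2T rotations break at most 2T blocks, so at least four blocks are intact and trap neither end.
Take two of them. Rotating the front end inside the earlier block and the back end inside the later
one gives two disjoint sets of at least `m` ends, which can be varied independently. An edge between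
them closes a longest path (`exists_closed_of_not_trapped`), and by connectivity this cycle is
Hamiltonian. -/

namespace SimpleGraph

open List

variable {V : Type*}

/-! ### Pósa rotations -/

/-- `u` and `v` are consecutive entries of `l`, in either order. -/
def Link (l : List V) (u v : V) : Prop := [u, v] <:+: l ∨ [v, u] <:+: l

theorem Link.symm {l : List V} {u v : V} (h : Link l u v) : Link l v u := Or.symm h

theorem append_cons_inj_of_nodup {w : V} {p q p' q' : List V} (hn : (p ++ w :: q).Nodup)
    (h : p ++ w :: q = p' ++ w :: q') : p = p' ∧ q = q' := by
  have hn' := h ▸ hn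
  rw [List.nodup_append] at hn hn'
  have h1 : w ∉ p := fun hw => hn.2.2 w hw w (by simp) rfl
  have h2 : w ∉ q := (List.nodup_cons.1 hn.2.1).1
  have := (List.append_cons_inj_of_notMem h1 h2).1 h
  exact ⟨this.1, this.2.2⟩

theorem Link.eq_or_of_split {l p q : List V} {z w u : V} (hn : l.Nodup)
    (hl : l = p ++ z :: w :: q) (h : Link l w u) : u = z ∨ [u] <+: q := by
  rcases h with ⟨a, b, h⟩ | ⟨a, b, h⟩
  · right
    have h1 : (p ++ [z]) ++ w :: q = a ++ w :: (u :: b) := by rw [hl] at h; simpa using h.symm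
    have := append_cons_inj_of_nodup (by rw [hl] at hn; simpa using hn) h1
    exact ⟨b, by simp [this.2]⟩
  · left
    have h1 : (p ++ [z]) ++ w :: q = (a ++ [u]) ++ w :: b := by rw [hl] at h; simpa using h.symm
    have := append_cons_inj_of_nodup (by rw [hl] at hn; simpa using hn) h1
    have := this.1
    simp at this
    exact this.2.symm

theorem exists_split_pred {l : List V} {w u v : V} (hn : l.Nodup) (hw : l.head? ≠ some w)
    (hu : Link l w u) (hv : Link l w v) (huv : u ≠ v) :
    ∃ p z q, l = p ++ z :: w :: q ∧ (z = u ∨ z = v) := by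
  have hmem : w ∈ l := by
    rcases hu with h | h
    · exact h.subset (by simp)
    · exact h.subset (by simp)
  obtain ⟨p', q, rfl⟩ := List.append_of_mem hmem
  rcases List.eq_nil_or_concat p' with rfl | ⟨p, z, rfl⟩
  · simp at hw
  · refine ⟨p, z, q, by simp, ?_⟩
    have e : p.concat z ++ w :: q = p ++ z :: w :: q := by simp
    rcases hu.eq_or_of_split hn e with h | ⟨b, h⟩
    · exact Or.inl h.symm
    rcases hv.eq_or_of_split hn e with h' | ⟨b', h'⟩
    · exact Or.inr h'.symm
    · rw [← h] at h'; simp at h'; exact absurd h'.1.symm huv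

/-- A Pósa rotation of the path `l` at its first vertex, keeping the last vertex fixed, which
deletes the edge `zw` with both ends in `W` and has `z` as its new first vertex. -/
def IsRotation (G : SimpleGraph V) (W : Set V) (l l' : List V) : Prop :=
  ∃ p z w q, l = p ++ z :: w :: q ∧ z ∈ W ∧ w ∈ W ∧ (∃ x, l.head? = some x ∧ G.Adj x w) ∧
    l' = z :: p.reverse ++ w :: q

/-- `Reach G W n l l'`: the path `l'` arises from `l` by at most `n` rotations that delete edges
with both ends in `W`. -/
inductive Reach (G : SimpleGraph V) (W : Set V) : ℕ → List V → List V → Prop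
  | refl (n : ℕ) (l : List V) : Reach G W n l l
  | step {n : ℕ} {l l' l'' : List V} :
      Reach G W n l l' → IsRotation G W l' l'' → Reach G W (n + 1) l l''

variable {G : SimpleGraph V} {W : Set V} {l l' : List V} {n : ℕ}

theorem Reach.succ (h : Reach G W n l l') : Reach G W (n + 1) l l' := by
  induction h with
  | refl n l => exact .refl _ _
  | step _ hr ih => exact .step ih hr

theorem Reach.mono {k : ℕ} (h : Reach G W n l l') (hk : n ≤ k) : Reach G W k l l' := by
  induction hk with
  | refl => exact h
  | step _ ih => exact ih.succ

theorem IsRotation.perm (h : IsRotation G W l l') : l' ~ l := by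
  obtain ⟨p, z, w, q, rfl, -, -, -, rfl⟩ := h
  have : z :: p.reverse ~ p ++ [z] := by
    have := List.reverse_perm (p ++ [z])
    simpa using this
  have h2 := this.append_right (w :: q)
  simpa using h2

theorem IsRotation.isChain (h : IsRotation G W l l') (hc : l.IsChain G.Adj) :
    l'.IsChain G.Adj := by
  obtain ⟨p, z, w, q, rfl, -, -, ⟨x, hx, hxw⟩, rfl⟩ := h
  have e : p ++ z :: w :: q = (p ++ [z]) ++ w :: q := by simp
  rw [e] at hc hx
  rw [List.isChain_append] at hc
  have e' : z :: p.reverse = (p ++ [z]).reverse := by simp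
  rw [e', List.isChain_append]
  refine ⟨?_, hc.2.1, ?_⟩
  · rw [List.isChain_reverse]
    exact hc.1.imp fun a b h => h.symm
  · intro a ha b hb
    have hne : p ++ [z] ≠ [] := by simp
    rw [List.getLast?_reverse] at ha
    rw [List.head?_append_of_ne_nil _ hne] at hx
    rw [hx] at ha
    simp at ha hb
    subst ha hb
    exact hxw

theorem IsRotation.getLast? (h : IsRotation G W l l') : l'.getLast? = l.getLast? := by
  obtain ⟨p, z, w, q, rfl, -, -, -, rfl⟩ := h
  simp [List.getLast?_cons, List.getLast?_append]

/-- The only consecutive pair destroyed is the deleted edge `zw`, and `z` becomes the new first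
vertex. -/
theorem IsRotation.link (h : IsRotation G W l l') {u v : V} (hl : Link l u v) :
    Link l' u v ∨ l'.head? = some u ∨ l'.head? = some v := by
  obtain ⟨p, z, w, q, rfl, -, -, -, rfl⟩ := h
  have key : ∀ a b : V, [a, b] <:+: p ++ z :: w :: q →
      Link (z :: p.reverse ++ w :: q) a b ∨ a = z := by
    intro a b hab
    have e : p ++ z :: w :: q = (p ++ [z]) ++ w :: q := by simp
    rw [e, List.infix_append_iff_ne_nil] at hab
    rcases hab with h | h | ⟨s, t, hs, ht, hst, h1, h2⟩
    · left; right
      have := List.reverse_infix.2 h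
      simp only [List.reverse_cons, List.reverse_append, List.reverse_nil, List.nil_append,
        List.cons_append] at this
      exact this.trans (List.infix_append [] _ _)
    · left; left
      exact h.trans (List.suffix_append _ _).isInfix
    · right
      match s, t, hs, ht, hst with
      | [c], [d], _, _, hst =>
        simp at hst
        obtain ⟨r, hr⟩ := h1
        have := List.append_inj' hr rfl
        simp at this
        rw [hst.1, this.2]
      | [_], _ :: _ :: _, _, _, hst => simp at hst
      | _ :: _ :: _, _ :: _, _, _, hst => simp at hst
  rcases hl with h | h
  · rcases key u v h with h | h
    · exact Or.inl h
    · right; left; simp [h]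
  · rcases key v u h with h | h
    · exact Or.inl h.symm
    · right; right; simp [h]

theorem Reach.perm (h : Reach G W n l l') : l' ~ l := by
  induction h with
  | refl n l => exact .refl _
  | step _ hr ih => exact hr.perm.trans ih

theorem Reach.isChain (h : Reach G W n l l') (hc : l.IsChain G.Adj) : l'.IsChain G.Adj := by
  induction h with
  | refl n l => exact hc
  | step _ hr ih => exact hr.isChain (ih hc)

theorem Reach.getLast? (h : Reach G W n l l') : l'.getLast? = l.getLast? := by
  induction h with
  | refl n l => rfl
  | step _ hr ih => exact hr.getLast?.trans ih

/-- First vertices of the paths which arise from `l` by at most `n` rotations. -/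
def rotEnds (G : SimpleGraph V) (W : Set V) (n : ℕ) (l : List V) : Set V :=
  {x | ∃ l', Reach G W n l l' ∧ l'.head? = some x}

theorem rotEnds_mono {k : ℕ} (hk : n ≤ k) : rotEnds G W n l ⊆ rotEnds G W k l :=
  fun _ ⟨l', h, hx⟩ => ⟨l', h.mono hk, hx⟩

theorem rotEnds_subset : ∀ x ∈ rotEnds G W n l, x ∈ l :=
  fun _ ⟨_, h, hx⟩ => h.perm.subset (List.mem_of_mem_head? (by simp [hx]))

theorem Reach.link (h : Reach G W n l l') {u v : V} (hl : Link l u v) :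
    Link l' u v ∨ u ∈ rotEnds G W n l ∨ v ∈ rotEnds G W n l := by
  induction h with
  | refl n l => exact Or.inl hl
  | @step n l l₁ l₂ h₁ hr ih =>
    rcases ih hl with h | h | h
    · rcases hr.link h with h | h | h
      · exact Or.inl h
      · exact Or.inr (Or.inl ⟨_, h₁.step hr, h⟩)
      · exact Or.inr (Or.inr ⟨_, h₁.step hr, h⟩)
    · exact Or.inr (Or.inl (rotEnds_mono (Nat.le_succ _) h))
    · exact Or.inr (Or.inr (rotEnds_mono (Nat.le_succ _) h))

/-- Pósa's lemma. -/
theorem mem_rotEnds_of_adj (hn : l.Nodup) {x u w v : V} (hx : x ∈ rotEnds G W n l)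
    (hxw : G.Adj x w) (hinf : [u, w, v] <:+: l) (hu : u ∈ W) (hw : w ∈ W) (hv : v ∈ W) :
    u ∈ rotEnds G W (n + 1) l ∨ w ∈ rotEnds G W (n + 1) l ∨ v ∈ rotEnds G W (n + 1) l := by
  -- If none of the three vertices becomes an end, `w` keeps both neighbours `u` and `v` on every
  -- rotated path. Using the edge `xw` then deletes `wu` or `wv` and makes `u` or `v` an end after
  -- all.
  by_contra! hcon
  obtain ⟨h1, h2, h3⟩ := hcon
  have hm := rotEnds_mono (G := G) (W := W) (l := l) (Nat.le_succ n)
  obtain ⟨l', hl', hx⟩ := hx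
  have hne : u ≠ v := by
    have := hinf.sublist.nodup hn
    simp at this
    exact this.1.2
  have i1 : [u, w] <:+: l := (List.prefix_append [u, w] [v]).isInfix.trans hinf
  have i2 : [w, v] <:+: l := (List.suffix_append [u] [w, v]).isInfix.trans hinf
  have l1 : Link l' w u := by
    rcases hl'.link (u := w) (v := u) (Or.inr i1) with h | h | h
    · exact h
    · exact absurd (hm h) h2
    · exact absurd (hm h) h1
  have l2 : Link l' w v := by
    rcases hl'.link (u := w) (v := v) (Or.inl i2) with h | h | h
    · exact h
    · exact absurd (hm h) h2
    · exact absurd (hm h) h3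
  have hw' : l'.head? ≠ some w := fun h => h2 (hm ⟨l', hl', h⟩)
  obtain ⟨p, z, q, rfl, hz⟩ := exists_split_pred (hl'.perm.nodup_iff.2 hn) hw' l1 l2 hne
  have hzW : z ∈ W := by rcases hz with rfl | rfl <;> assumption
  have hz' : z ∈ rotEnds G W (n + 1) l :=
    ⟨_, hl'.step ⟨p, z, w, q, rfl, hzW, hw, ⟨x, hx, hxw⟩, rfl⟩, by simp⟩
  rcases hz with rfl | rfl
  · exact h1 hz'
  · exact h3 hz'


/-! ### Rotation-closed sets and trapped vertices -/

/-- Any two disjoint sets of at least `m` vertices are joined by an edge. -/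
def IsJoined (G : SimpleGraph V) (m : ℕ) : Prop :=
  ∀ X Y : Finset V, Disjoint X Y → m ≤ X.card → m ≤ Y.card → ∃ x ∈ X, ∃ y ∈ Y, G.Adj x y

/-- `X` is closed under Pósa rotations into the interior of the list `s`. -/
def IsRotClosed (G : SimpleGraph V) (s : List V) (X : Finset V) : Prop :=
  ∀ x ∈ X, ∀ u w v, [u, w, v] <:+: s → G.Adj x w → u ∈ X ∨ w ∈ X ∨ v ∈ X

/-- The vertex `a` lies in a small set that is closed under rotations into `s`. -/
def IsTrapped (G : SimpleGraph V) (m : ℕ) (s : List V) (a : V) : Prop :=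
  ∃ X : Finset V, a ∈ X ∧ X.card < m ∧ IsRotClosed G s X

theorem eq_of_infix_pair_right {s : List V} (hn : s.Nodup) {u w w' : V} (h : [u, w] <:+: s)
    (h' : [u, w'] <:+: s) : w = w' := by
  obtain ⟨a, b, rfl⟩ := h
  obtain ⟨a', b', h'⟩ := h'
  have := append_cons_inj_of_nodup (w := u) (p := a) (q := w :: b) (p' := a') (q' := w' :: b')
    (by simpa using hn) (by simpa using h'.symm)
  exact (List.cons.inj this.2).1

theorem eq_of_infix_pair_left {s : List V} (hn : s.Nodup) {u w w' : V} (h : [w, u] <:+: s)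
    (h' : [w', u] <:+: s) : w = w' := by
  refine eq_of_infix_pair_right (s := s.reverse) (u := u) (by simpa using hn) ?_ ?_
  · simpa using List.reverse_infix.2 h
  · simpa using List.reverse_infix.2 h'

open Classical in
-- A vertex of `U` accounts for at most three middle vertices: itself, its successor and its
-- predecessor.
theorem card_filter_triple_le [Fintype V] {s : List V} (hn : s.Nodup) (U : Finset V) :
    (Finset.univ.filter fun w => ∃ u v, [u, w, v] <:+: s ∧ (u ∈ U ∨ w ∈ U ∨ v ∈ U)).card
      ≤ 3 * U.card := by
  let A := U.biUnion fun u => Finset.univ.filter fun w => [u, w] <:+: s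
  let B := U.biUnion fun v => Finset.univ.filter fun w => [w, v] <:+: s
  have hA : A.card ≤ U.card * 1 := by
    refine Finset.card_biUnion_le_card_mul _ _ _ fun u _ => Finset.card_le_one.2 ?_
    intro a ha b hb
    exact eq_of_infix_pair_right hn (Finset.mem_filter.1 ha).2 (Finset.mem_filter.1 hb).2
  have hB : B.card ≤ U.card * 1 := by
    refine Finset.card_biUnion_le_card_mul _ _ _ fun u _ => Finset.card_le_one.2 ?_
    intro a ha b hb
    exact eq_of_infix_pair_left hn (Finset.mem_filter.1 ha).2 (Finset.mem_filter.1 hb).2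
  have hsub : (Finset.univ.filter fun w => ∃ u v, [u, w, v] <:+: s ∧ (u ∈ U ∨ w ∈ U ∨ v ∈ U))
      ⊆ U ∪ (A ∪ B) := by
    intro w hw
    obtain ⟨u, v, hi, h⟩ := (Finset.mem_filter.1 hw).2
    rcases h with h | h | h
    · refine Finset.mem_union_right _ (Finset.mem_union_left _ (Finset.mem_biUnion.2 ⟨u, h, ?_⟩))
      exact Finset.mem_filter.2
        ⟨Finset.mem_univ _, (List.prefix_append [u, w] [v]).isInfix.trans hi⟩
    · exact Finset.mem_union_left _ h
    · refine Finset.mem_union_right _ (Finset.mem_union_right _ (Finset.mem_biUnion.2 ⟨v, h, ?_⟩))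
      exact Finset.mem_filter.2
        ⟨Finset.mem_univ _, (List.suffix_append [u] [w, v]).isInfix.trans hi⟩
  have h1 := Finset.card_le_card hsub
  have h2 := Finset.card_union_le U (A ∪ B)
  have h3 := Finset.card_union_le A B
  omega

theorem exists_triple_of_mem {s : List V} {w : V} (hw : w ∈ s) (h1 : s.head? ≠ some w)
    (h2 : s.getLast? ≠ some w) : ∃ u v, [u, w, v] <:+: s := by
  obtain ⟨p, q, rfl⟩ := List.append_of_mem hw
  rcases List.eq_nil_or_concat p with rfl | ⟨p, u, rfl⟩
  · simp at h1
  · cases q with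
    | nil => simp at h2
    | cons v q => exact ⟨u, v, p, q, by simp⟩

open Classical in
-- By closure, edges from `U` reach interior vertices of `s` only at or beside `U`. Fewer than 6m
-- vertices are of this kind, so even without the two end vertices at least `m` vertices of `s`
-- receive no edge from `U`, against joinedness.
theorem card_closed_lt [Fintype V] {G : SimpleGraph V} {m : ℕ} (hJ : G.IsJoined m) {s : List V}
    (hn : s.Nodup) (hs : 7 * m + 2 ≤ s.length) {U : Finset V} (hU : IsRotClosed G s U)
    (h1 : m ≤ U.card) (h2 : U.card < 2 * m) : False := by
  set T := Finset.univ.filter fun w => ∃ u v, [u, w, v] <:+: s ∧ (u ∈ U ∨ w ∈ U ∨ v ∈ U) with hT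
  have hTc : T.card ≤ 3 * U.card := card_filter_triple_le hn U
  have hne : s ≠ [] := by rintro rfl; simp at hs
  let Y := s.toFinset \ (T ∪ {s.head hne, s.getLast hne})
  have hYt : ∀ w ∈ Y, ∃ u v, [u, w, v] <:+: s := by
    intro w hw
    simp only [Y, Finset.mem_sdiff, List.mem_toFinset, Finset.mem_union, Finset.mem_insert,
      Finset.mem_singleton, not_or] at hw
    refine exists_triple_of_mem hw.1 ?_ ?_
    · rw [List.head?_eq_some_head hne]
      exact fun h => hw.2.2.1 (Option.some.inj h).symm
    · rw [List.getLast?_eq_some_getLast hne]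
      exact fun h => hw.2.2.2 (Option.some.inj h).symm
  have hYT : ∀ w ∈ Y, w ∉ T := by
    intro w hw hwT
    exact (Finset.mem_sdiff.1 hw).2 (Finset.mem_union_left _ hwT)
  have hYc : m ≤ Y.card := by
    have a1 : s.toFinset.card - (T ∪ {s.head hne, s.getLast hne}).card ≤ Y.card :=
      Finset.le_card_sdiff _ _
    have a2 := Finset.card_union_le T {s.head hne, s.getLast hne}
    have a3 : ({s.head hne, s.getLast hne} : Finset V).card ≤ 2 := Finset.card_le_two
    rw [List.toFinset_card_of_nodup hn] at a1
    omega
  have hd : Disjoint U Y := by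
    rw [Finset.disjoint_left]
    intro w hw hY
    obtain ⟨u, v, hi⟩ := hYt w hY
    exact hYT w hY (Finset.mem_filter.2 ⟨Finset.mem_univ _, u, v, hi, Or.inr (Or.inl hw)⟩)
  obtain ⟨x, hx, y, hy, hxy⟩ := hJ U Y hd h1 hYc
  obtain ⟨u, v, hi⟩ := hYt y hy
  exact hYT y hy (Finset.mem_filter.2 ⟨Finset.mem_univ _, u, v, hi, hU x hx u y v hi hxy⟩)

open Classical in
-- Closed sets are stable under union, and none has size in [m, 2m). Adding small closed sets one at
-- a time therefore never leaves the range below `m`.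
theorem card_trapped_lt [Fintype V] {G : SimpleGraph V} {m : ℕ} (hJ : G.IsJoined m) {s : List V}
    (hn : s.Nodup) (hs : 7 * m + 2 ≤ s.length) :
    (Finset.univ.filter fun a => IsTrapped G m s a).card < m := by
  have hm : 0 < m := by
    rcases Nat.eq_zero_or_pos m with rfl | h
    · obtain ⟨x, hx, -⟩ := hJ ∅ ∅ (by simp) (by simp) (by simp)
      simp at hx
    · exact h
  have key : ∀ A : Finset V, (∀ a ∈ A, IsTrapped G m s a) →
      ∃ U : Finset V, A ⊆ U ∧ U.card < m ∧ IsRotClosed G s U := by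
    intro A
    induction A using Finset.induction_on with
    | empty => exact fun _ => ⟨∅, by simp, by simpa using hm, fun x hx => by simp at hx⟩
    | insert a A _ ih =>
      intro h
      obtain ⟨U, hAU, hUm, hU⟩ := ih fun b hb => h b (Finset.mem_insert_of_mem hb)
      obtain ⟨X, haX, hXm, hX⟩ := h a (Finset.mem_insert_self _ _)
      have hcl : IsRotClosed G s (U ∪ X) := by
        intro x hx u w v hi hxw
        rcases Finset.mem_union.1 hx with hx | hx
        · rcases hU x hx u w v hi hxw with h | h | h <;> simp [h]
        · rcases hX x hx u w v hi hxw with h | h | h <;> simp [h]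
      have hc := Finset.card_union_le U X
      refine ⟨U ∪ X, ?_, ?_, hcl⟩
      · intro b hb
        rcases Finset.mem_insert.1 hb with rfl | hb
        · exact Finset.mem_union_right _ haX
        · exact Finset.mem_union_left _ (hAU hb)
      · by_contra hge
        exact card_closed_lt hJ hn hs hcl (by omega) (by omega)
  obtain ⟨U, hAU, hUm, -⟩ := key (Finset.univ.filter fun a => IsTrapped G m s a)
    fun a ha => (Finset.mem_filter.1 ha).2
  exact (Finset.card_le_card hAU).trans_lt hUm

/-! ### Blocks of a path under rotation -/

/-- The list `s`, or its reverse, is a contiguous part of `l`. -/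
def Unbroken (l s : List V) : Prop := s <:+: l ∨ s.reverse <:+: l

theorem Unbroken.reverse {l s : List V} (h : Unbroken l s) : Unbroken l.reverse s := by
  rcases h with h | h
  · exact Or.inr (List.reverse_infix.2 h)
  · left
    simpa using List.reverse_infix.2 h

/-- Only the junction in front of `w` is cut, so a block avoiding `w` survives up to reversal. Of
several disjoint blocks, one rotation breaks at most one. -/
theorem IsRotation.exists_unbroken {G : SimpleGraph V} {W : Set V} {l l' : List V}
    (h : IsRotation G W l l') : ∃ w, ∀ s, w ∉ s → Unbroken l s → Unbroken l' s := by
  obtain ⟨p, z, w, q, rfl, -, -, -, rfl⟩ := h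
  refine ⟨w, ?_⟩
  have key : ∀ s, w ∉ s → s <:+: p ++ z :: w :: q →
      Unbroken (z :: p.reverse ++ w :: q) s := by
    intro s hw hs
    have e : p ++ z :: w :: q = (p ++ [z]) ++ w :: q := by simp
    rw [e, List.infix_append_iff_ne_nil] at hs
    rcases hs with h | h | ⟨a, b, ha, hb, rfl, h1, h2⟩
    · right
      have := List.reverse_infix.2 h
      simp only [List.reverse_append, List.reverse_cons, List.reverse_nil, List.nil_append,
        List.cons_append] at this
      exact this.trans (List.infix_append [] _ _)
    · left
      exact h.trans (List.suffix_append _ _).isInfix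
    · exfalso
      apply hw
      obtain ⟨r, hr⟩ := h2
      cases b with
      | nil => exact absurd rfl hb
      | cons c b =>
        simp at hr
        simp [hr.1]
  intro s hw hs
  rcases hs with hs | hs
  · exact key s hw hs
  · rcases key s.reverse (by simpa using hw) hs with h | h
    · exact Or.inr h
    · exact Or.inl (by simpa using h)

open Classical in
theorem Reach.card_unbroken_le {G : SimpleGraph V} {W : Set V} {l l' : List V} {n N : ℕ}
    {s : ℕ → List V} (hs : ∀ i < N, ∀ j < N, i ≠ j → List.Disjoint (s i) (s j))
    (h : Reach G W n l l') :
    ((Finset.range N).filter fun i => Unbroken l (s i)).card ≤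
      ((Finset.range N).filter fun i => Unbroken l' (s i)).card + n := by
  induction h with
  | refl n l => omega
  | @step n l l₁ l₂ h₁ hr ih =>
    obtain ⟨w, hw⟩ := hr.exists_unbroken
    have h1 : ((Finset.range N).filter fun i => w ∈ s i).card ≤ 1 := by
      refine Finset.card_le_one.2 fun i hi j hj => ?_
      simp only [Finset.mem_filter, Finset.mem_range] at hi hj
      by_contra hij
      exact hs i hi.1 j hj.1 hij hi.2 hj.2
    have h2 : ((Finset.range N).filter fun i => Unbroken l₁ (s i)) ⊆
        ((Finset.range N).filter fun i => Unbroken l₂ (s i)) ∪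
          ((Finset.range N).filter fun i => w ∈ s i) := by
      intro i hi
      simp only [Finset.mem_filter, Finset.mem_union] at hi ⊢
      by_cases hwi : w ∈ s i
      · exact Or.inr ⟨hi.1, hwi⟩
      · exact Or.inl ⟨hi.1, hw _ hwi hi.2⟩
    have h3 := Finset.card_le_card h2
    have h4 := Finset.card_union_le ((Finset.range N).filter fun i => Unbroken l₂ (s i))
      ((Finset.range N).filter fun i => w ∈ s i)
    omega

/-- A duplicate-free list has disjoint contiguous parts of prescribed length. -/
theorem exists_blocks {l : List V} (hn : l.Nodup) {N k : ℕ} (h : N * k ≤ l.length) :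
    ∃ s : ℕ → List V, (∀ i < N, (s i).length = k ∧ s i <:+: l) ∧
      ∀ i < N, ∀ j < N, i ≠ j → List.Disjoint (s i) (s j) := by
  induction N generalizing l with
  | zero => exact ⟨fun _ => [], by simp, by simp⟩
  | succ N ih =>
    have hk : N * k + k ≤ l.length := by rw [Nat.succ_mul] at h; exact h
    obtain ⟨s, hs, hd⟩ := ih (l := l.drop k) (hn.sublist (List.drop_sublist _ _))
      (by rw [List.length_drop]; omega)
    have hdis : List.Disjoint (l.take k) (l.drop k) := by
      rw [← List.take_append_drop k l] at hn
      exact List.disjoint_of_nodup_append hn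
    have hsub : ∀ i < N, s i ⊆ l.drop k := fun i hi => (hs i hi).2.subset
    refine ⟨fun i => Nat.casesOn i (l.take k) s, ?_, ?_⟩
    · rintro (_ | i) hi
      · exact ⟨by simp; omega, (List.take_prefix _ _).isInfix⟩
      · have := hs i (by omega)
        exact ⟨this.1, this.2.trans (List.drop_suffix _ _).isInfix⟩
    · rintro (_ | i) hi (_ | j) hj hij
      · exact absurd rfl hij
      · exact List.disjoint_of_subset_right (hsub j (by omega)) hdis
      · exact (List.disjoint_of_subset_right (hsub i (by omega)) hdis).symm
      · exact hd i (by omega) j (by omega) (by omega)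


/-! ### Closing a path by rotations inside two blocks -/

theorem IsTrapped.reverse {G : SimpleGraph V} {m : ℕ} {s : List V} {a : V}
    (h : IsTrapped G m s.reverse a) : IsTrapped G m s a := by
  obtain ⟨X, ha, hX, hc⟩ := h
  refine ⟨X, ha, hX, fun x hx u w v hi hxw => ?_⟩
  have := hc x hx v w u (by simpa using List.reverse_infix.2 hi) hxw
  tauto

open Classical in
-- The set of all ends obtainable by rotations inside `s` contains `a` and is closed by Pósa's
-- lemma; were it smaller than `m`, it would trap `a`.
theorem le_card_rotEnds [Fintype V] {G : SimpleGraph V} {m : ℕ} {p s : List V} {a : V}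
    (hn : (p ++ s).Nodup) (ha : (p ++ s).head? = some a) (ht : ¬ IsTrapped G m s a) :
    m ≤ (Finset.univ.filter fun x => ∃ n, x ∈ rotEnds G {w | w ∈ s} n (p ++ s)).card := by
  by_contra! hlt
  refine ht ⟨_, ?_, hlt, ?_⟩
  · exact Finset.mem_filter.2 ⟨Finset.mem_univ _, 0, _, .refl _ _, ha⟩
  · intro x hx u w v hi hxw
    obtain ⟨n, hx⟩ := (Finset.mem_filter.1 hx).2
    have h := mem_rotEnds_of_adj hn hx hxw (hi.trans (List.suffix_append _ _).isInfix)
      (hi.subset (by simp)) (hi.subset (by simp)) (hi.subset (by simp))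
    simp only [Finset.mem_filter, Finset.mem_univ, true_and]
    rcases h with h | h | h
    · exact Or.inl ⟨_, h⟩
    · exact Or.inr (Or.inl ⟨_, h⟩)
    · exact Or.inr (Or.inr ⟨_, h⟩)

/-- A path both of whose ends escape by rotations into disjoint parts of it closes to a cycle. -/
theorem exists_closed_of_not_trapped [Fintype V] {G : SimpleGraph V} {m : ℕ} (hJ : G.IsJoined m)
    {p s q t r : List V} {a b : V} (hn : (p ++ s ++ q ++ (t ++ r)).Nodup)
    (hc : (p ++ s ++ q ++ (t ++ r)).IsChain G.Adj) (hs : s ≠ []) (ht : t ≠ [])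
    (ha : (p ++ s ++ q ++ (t ++ r)).head? = some a)
    (hb : (p ++ s ++ q ++ (t ++ r)).getLast? = some b)
    (has : ¬ IsTrapped G m s a) (hbt : ¬ IsTrapped G m t b) :
    ∃ c x y, c ~ p ++ s ++ q ++ (t ++ r) ∧ c.IsChain G.Adj ∧ c.head? = some x ∧
      c.getLast? = some y ∧ G.Adj y x := by
  classical
  have hps : p ++ s ≠ [] := by simp [hs]
  have htr : t ++ r ≠ [] := by simp [ht]
  have hn' := List.nodup_append.1 hn
  have hn1 : (p ++ s).Nodup := (List.nodup_append.1 hn'.1).1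
  have hn2 : (r.reverse ++ t.reverse).Nodup := by
    rw [← List.reverse_append, List.nodup_reverse]; exact hn'.2.1
  have ha' : (p ++ s).head? = some a := by
    rw [List.append_assoc, List.head?_append_of_ne_nil _ hps] at ha; exact ha
  have hb' : (r.reverse ++ t.reverse).head? = some b := by
    rw [List.getLast?_append_of_ne_nil _ htr] at hb
    rw [← List.reverse_append, List.head?_reverse]; exact hb
  have hX := le_card_rotEnds hn1 ha' has
  have hY := le_card_rotEnds (G := G) (m := m) hn2 hb' (fun h => hbt h.reverse)
  have hXm : ∀ x, (∃ n, x ∈ rotEnds G {w | w ∈ s} n (p ++ s)) → x ∈ p ++ s :=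
    fun x ⟨n, h⟩ => rotEnds_subset x h
  have hYm : ∀ x, (∃ n, x ∈ rotEnds G {w | w ∈ t.reverse} n (r.reverse ++ t.reverse)) →
      x ∈ t ++ r := fun x ⟨n, h⟩ => by
    have := rotEnds_subset x h
    rw [← List.reverse_append, List.mem_reverse] at this; exact this
  obtain ⟨x, hx, y, hy, hxy⟩ := hJ _ _ (by
    rw [Finset.disjoint_left]
    intro w h1 h2
    exact hn'.2.2 w (List.mem_append_left _ (hXm w (Finset.mem_filter.1 h1).2)) w
      (hYm w (Finset.mem_filter.1 h2).2) rfl) hX hY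
  obtain ⟨n, l₁, h₁, hx⟩ := (Finset.mem_filter.1 hx).2
  obtain ⟨k, l₂, h₂, hy⟩ := (Finset.mem_filter.1 hy).2
  have hc' := List.isChain_append.1 hc
  have hc'' := List.isChain_append.1 hc'.1
  have c1 := h₁.isChain hc''.1
  have c2 := h₂.isChain (by
    rw [← List.reverse_append, List.isChain_reverse]; exact hc'.2.1.imp fun a b h => h.symm)
  have e1 := h₁.getLast?
  have e2 := h₂.getLast?
  have hl₁ : l₁ ≠ [] := by rintro rfl; simp at hx
  have hl₂ : l₂ ≠ [] := by rintro rfl; simp at hy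
  have e2' : l₂.reverse.head? = (t ++ r).head? := by
    rw [List.head?_reverse, e2, ← List.reverse_append, List.getLast?_reverse]
  have hperm2 : l₂.reverse ~ t ++ r := by
    have := (List.reverse_perm l₂).trans h₂.perm
    rw [← List.reverse_append] at this
    exact this.trans (List.reverse_perm _)
  -- Rotations fix the last vertex, so both rotated pieces still attach to what lies between them.
  refine ⟨l₁ ++ q ++ l₂.reverse, x, y, (h₁.perm.append_right q).append hperm2, ?_, ?_, ?_, hxy.symm⟩
  · refine List.isChain_append.2 ⟨List.isChain_append.2 ⟨c1, hc''.2.1, ?_⟩, ?_, ?_⟩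
    · rw [e1]; exact hc''.2.2
    · rw [List.isChain_reverse]; exact c2.imp fun a b h => h.symm
    · rw [e2']
      have : (l₁ ++ q).getLast? = (p ++ s ++ q).getLast? := by
        rw [List.getLast?_append (l := l₁), List.getLast?_append (l := p ++ s), e1]
      rw [this]; exact hc'.2.2
  · rw [List.append_assoc, List.head?_append_of_ne_nil _ hl₁]; exact hx
  · rw [List.getLast?_append_of_ne_nil _ (by simpa using hl₂), List.getLast?_reverse]; exact hy

theorem split_of_two_infix {l s t : List V} (hs : s ≠ []) (ht : t ≠ []) (hd : List.Disjoint s t)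
    (h1 : s <:+: l) (h2 : t <:+: l) :
    (∃ p q r, l = p ++ s ++ q ++ (t ++ r)) ∨ ∃ p q r, l = p ++ t ++ q ++ (s ++ r) := by
  obtain ⟨p, r, rfl⟩ := h1
  rw [List.infix_append_iff_ne_nil] at h2
  rcases h2 with h | ⟨q, r', rfl⟩ | ⟨a, b, ha, hb, rfl, h1, h2⟩
  · rw [List.infix_append_iff_ne_nil] at h
    rcases h with ⟨p', q, rfl⟩ | h | ⟨a, b, ha, hb, rfl, h1, h2⟩
    · right; exact ⟨p', q, r, by simp⟩
    · obtain ⟨x, hx⟩ := List.exists_mem_of_ne_nil t ht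
      exact absurd hx (hd (h.subset hx))
    · obtain ⟨x, hx⟩ := List.exists_mem_of_ne_nil b hb
      exact absurd (List.mem_append_right _ hx) (hd (h2.subset hx))
  · left; exact ⟨p, q, r', by simp⟩
  · exfalso
    have e : (p ++ s).getLast? = a.getLast? := by
      obtain ⟨c, hc⟩ := h1
      rw [← hc, List.getLast?_append_of_ne_nil _ ha]
    rw [List.getLast?_append_of_ne_nil _ hs, List.getLast?_eq_some_getLast hs,
      List.getLast?_eq_some_getLast ha] at e
    have e := Option.some.inj e
    exact hd (List.getLast_mem hs) (by rw [e]; exact List.mem_append_left _ (List.getLast_mem ha))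

/-! ### Longest paths -/

/-- `l` lists the vertices of a longest path of `G`. -/
structure IsLongestPath (G : SimpleGraph V) (l : List V) : Prop where
  nodup : l.Nodup
  isChain : l.IsChain G.Adj
  length_le : ∀ l' : List V, l'.Nodup → l'.IsChain G.Adj → l'.length ≤ l.length

theorem exists_isLongestPath [Fintype V] (G : SimpleGraph V) : ∃ l, G.IsLongestPath l := by
  classical
  have hle : ∀ n, (∃ l : List V, l.Nodup ∧ l.IsChain G.Adj ∧ l.length = n) →
      n ≤ Fintype.card V := by
    rintro n ⟨l, hl, -, rfl⟩
    exact hl.length_le_card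
  obtain ⟨l, h1, h2, h3⟩ := Nat.findGreatest_spec (P := fun n => ∃ l : List V, l.Nodup ∧
    l.IsChain G.Adj ∧ l.length = n) (Nat.zero_le (Fintype.card V)) ⟨[], by simp, by simp, rfl⟩
  refine ⟨l, h1, h2, fun l' h1' h2' => ?_⟩
  rw [h3]
  exact Nat.le_findGreatest (hle _ ⟨l', h1', h2', rfl⟩) ⟨l', h1', h2', rfl⟩

theorem IsLongestPath.of_perm {G : SimpleGraph V} {l l' : List V} (h : G.IsLongestPath l)
    (hp : l' ~ l) (hc : l'.IsChain G.Adj) : G.IsLongestPath l' :=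
  ⟨hp.nodup_iff.2 h.nodup, hc, fun k h1 h2 => hp.length_eq ▸ h.length_le k h1 h2⟩

theorem IsLongestPath.reverse {G : SimpleGraph V} {l : List V} (h : G.IsLongestPath l) :
    G.IsLongestPath l.reverse :=
  h.of_perm (List.reverse_perm _) (by
    rw [List.isChain_reverse]; exact h.isChain.imp fun a b h => h.symm)

theorem IsLongestPath.reach {G : SimpleGraph V} {W : Set V} {n : ℕ} {l l' : List V}
    (h : G.IsLongestPath l) (hr : Reach G W n l l') : G.IsLongestPath l' :=
  h.of_perm hr.perm (hr.isChain h.isChain)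

theorem IsLongestPath.mem_of_adj {G : SimpleGraph V} {l : List V} (h : G.IsLongestPath l)
    {x y : V} (hx : l.head? = some x) (hxy : G.Adj x y) : y ∈ l := by
  by_contra hy
  have := h.length_le (y :: l) (List.nodup_cons.2 ⟨hy, h.nodup⟩) (by
    rw [List.isChain_cons]
    refine ⟨fun z hz => ?_, h.isChain⟩
    rw [hx] at hz
    cases hz
    exact hxy.symm)
  simp at this

/-- A closed longest path in a connected graph is a Hamilton cycle. -/
theorem IsLongestPath.isHamiltonian [Fintype V] [DecidableEq V] {G : SimpleGraph V}
    (hconn : ∀ X : Finset V, X.Nonempty → X ≠ Finset.univ → ∃ x ∈ X, ∃ y ∉ X, G.Adj x y)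
    {l : List V} (h : G.IsLongestPath l) (h3 : 3 ≤ l.length) {x y : V}
    (hx : l.head? = some x) (hy : l.getLast? = some y) (hyx : G.Adj y x) :
    G.IsHamiltonian := by
  have hall : ∀ v, v ∈ l := by
    by_contra! hv
    obtain ⟨v, hv⟩ := hv
    obtain ⟨u, hu, w, hw, huw⟩ := hconn l.toFinset
      ⟨x, by simpa using List.mem_of_mem_head? (by simp [hx])⟩
      (fun e => hv (by have := Finset.mem_univ v; rw [← e] at this; simpa using this))
    rw [List.mem_toFinset] at hu hw
    obtain ⟨p, q, rfl⟩ := List.append_of_mem hu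
    have hc := List.isChain_append.1 h.isChain
    -- Opening the cycle at `u` gives a longest path starting at `u`, which the edge `uw` would
    -- extend.
    have hrot : G.IsLongestPath ((u :: q) ++ p) := by
      refine h.of_perm List.perm_append_comm (List.isChain_append.2 ⟨hc.2.1, hc.1, ?_⟩)
      intro a ha b hb
      have hp : p ≠ [] := by rintro rfl; simp at hb
      rw [List.head?_append_of_ne_nil _ hp] at hx
      rw [List.getLast?_append_of_ne_nil _ (by simp)] at hy
      rw [hy] at ha
      rw [hx] at hb
      cases ha
      cases hb
      exact hyx
    exact hw (List.perm_append_comm.subset (hrot.mem_of_adj (x := u) (by simp) huw))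
  have hne : l ≠ [] := by rintro rfl; simp at h3
  intro _
  have hxe : l.head hne = x := by
    rw [List.head?_eq_some_head hne] at hx; exact Option.some.inj hx
  have hye : l.getLast hne = y := by
    rw [List.getLast?_eq_some_getLast hne] at hy; exact Option.some.inj hy
  let p := Walk.ofSupport l hne h.isChain
  have hps : p.support = l := Walk.support_ofSupport hne h.isChain
  have hpath : p.IsPath := Walk.IsPath.mk' (by rw [hps]; exact h.nodup)
  have hadj : G.Adj (l.getLast hne) (l.head hne) := by rw [hxe, hye]; exact hyx
  refine ⟨l.getLast hne, Walk.cons hadj p, ?_⟩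
  rw [Walk.isHamiltonianCycle_iff_isCycle_and_support_count_tail_eq_one]
  refine ⟨?_, ?_⟩
  · rw [Walk.cons_isCycle_iff]
    refine ⟨hpath, fun he => ?_⟩
    -- The closing edge could repeat a path edge only on a path with two vertices; three are
    -- present.
    have hlen : p.length + 1 = l.length := by rw [← Walk.length_support, hps]
    rw [Sym2.eq_swap] at he
    have := hpath.length_eq_one_of_mem_edges he
    omega
  · intro a
    rw [Walk.support_cons, List.tail_cons, hps]
    exact List.count_eq_one_of_mem h.nodup (hall a)


/-! ### Growth of the end set and the Hamiltonicity criterion -/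

open Classical in
theorem IsLongestPath.pow_le_card_rotEnds [Fintype V] {G : SimpleGraph V} {m E : ℕ}
    (hgrow : ∀ S : Finset V, S.card ≤ 4 * m → ∃ N : Finset V, 4 * E * S.card ≤ N.card ∧
      ∀ w ∈ N, w ∉ S ∧ ∃ x ∈ S, G.Adj x w)
    {l : List V} (h : G.IsLongestPath l) (hne : l ≠ []) (t : ℕ) :
    E ^ t ≤ (Finset.univ.filter fun x => x ∈ rotEnds G Set.univ t l).card ∨
      4 * m < (Finset.univ.filter fun x => x ∈ rotEnds G Set.univ t l).card := by
  have hhead : ∀ t, l.head hne ∈ rotEnds G Set.univ t l := fun t =>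
    ⟨l, .refl _ _, List.head?_eq_some_head hne⟩
  induction t with
  | zero =>
    left
    rw [pow_zero, Nat.one_le_iff_ne_zero, ← Nat.pos_iff_ne_zero, Finset.card_pos]
    exact ⟨_, Finset.mem_filter.2 ⟨Finset.mem_univ _, hhead 0⟩⟩
  | succ t ih =>
    set S := Finset.univ.filter fun x => x ∈ rotEnds G Set.univ t l with hS
    set S' := Finset.univ.filter fun x => x ∈ rotEnds G Set.univ (t + 1) l with hS'
    have hSS' : S ⊆ S' := Finset.monotone_filter_right _ fun x _ hx => rotEnds_mono (Nat.le_succ t) hx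
    rcases lt_or_ge (4 * m) S.card with h4 | h4
    · exact Or.inr (h4.trans_le (Finset.card_le_card hSS'))
    rcases ih with ih | ih
    swap
    · exact absurd h4 (not_le.2 ih)
    left
    obtain ⟨N, h1, hN⟩ := hgrow S h4
    -- Neighbours of ends lie on the path by maximality. The first vertex is in `S`, hence not in
    -- `N`; the last one has no successor and is counted separately.
    have hsub : N ⊆ (Finset.univ.filter fun w => ∃ u v, [u, w, v] <:+: l ∧ (u ∈ S' ∨ w ∈ S' ∨ v ∈ S')) ∪
          {l.getLast hne} := by
      intro w hw
      obtain ⟨hwS, x, hx, hxw⟩ := hN w hw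
      have hx := (Finset.mem_filter.1 hx).2
      obtain ⟨l', hl', hx'⟩ := id hx
      have hwl : w ∈ l := hl'.perm.subset ((h.reach hl').mem_of_adj hx' hxw)
      by_cases hlast : w = l.getLast hne
      · exact Finset.mem_union_right _ (Finset.mem_singleton.2 hlast)
      refine Finset.mem_union_left _ (Finset.mem_filter.2 ⟨Finset.mem_univ _, ?_⟩)
      obtain ⟨u, v, hi⟩ := exists_triple_of_mem hwl (fun h1 => by
          rw [List.head?_eq_some_head hne] at h1
          exact hwS (Finset.mem_filter.2 ⟨Finset.mem_univ _, Option.some.inj h1 ▸ hhead t⟩))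
        (fun h1 => by
          rw [List.getLast?_eq_some_getLast hne] at h1
          exact hlast (Option.some.inj h1).symm)
      refine ⟨u, v, hi, ?_⟩
      simp only [hS', Finset.mem_filter, Finset.mem_univ, true_and]
      exact mem_rotEnds_of_adj h.nodup hx hxw hi trivial trivial trivial
    have h2 := Finset.card_le_card hsub
    have h3 := Finset.card_union_le
      (Finset.univ.filter fun w => ∃ u v, [u, w, v] <:+: l ∧ (u ∈ S' ∨ w ∈ S' ∨ v ∈ S'))
      {l.getLast hne}
    have h5 := card_filter_triple_le h.nodup S'
    have h6 : 0 < S'.card :=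
      Finset.card_pos.2 ⟨_, Finset.mem_filter.2 ⟨Finset.mem_univ _, hhead (t + 1)⟩⟩
    rw [Finset.card_singleton] at h3
    -- As `S'` is nonempty, 4E|S| ≤ 3|S'| + 1 ≤ 4|S'|; the factor 4 in the expansion is spent here.
    have h7 : E * S.card ≤ S'.card := by
      have : 4 * E * S.card = 4 * (E * S.card) := by ring
      omega
    calc E ^ (t + 1) = E * E ^ t := by ring
      _ ≤ E * S.card := Nat.mul_le_mul_left _ ih
      _ ≤ S'.card := h7

open Classical in
-- Double counting: 4(T+1) blocks trap at most `m` vertices each, and each vertex counted here uses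
-- up T+1 of these incidences.
theorem card_often_trapped_le [Fintype V] {G : SimpleGraph V} {m T : ℕ} (hJ : G.IsJoined m)
    {s : ℕ → List V} (hs : ∀ i < 4 * (T + 1), (s i).Nodup ∧ 7 * m + 2 ≤ (s i).length) :
    (Finset.univ.filter fun a => T + 1 ≤
      ((Finset.range (4 * (T + 1))).filter fun i => IsTrapped G m (s i) a).card).card ≤ 4 * m := by
  have h1 := Finset.sum_card_bipartiteAbove_eq_sum_card_bipartiteBelow
    (s := (Finset.univ : Finset V)) (t := Finset.range (4 * (T + 1)))
    (fun a i => IsTrapped G m (s i) a)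
  have h2 : ∑ i ∈ Finset.range (4 * (T + 1)),
      (Finset.univ.bipartiteBelow (fun a i => IsTrapped G m (s i) a) i).card ≤
        (Finset.range (4 * (T + 1))).card • m := by
    refine Finset.sum_le_card_nsmul _ _ _ fun i hi => ?_
    have := hs i (Finset.mem_range.1 hi)
    exact (card_trapped_lt hJ this.1 this.2).le
  set H := Finset.univ.filter fun a => T + 1 ≤
      ((Finset.range (4 * (T + 1))).filter fun i => IsTrapped G m (s i) a).card with hH
  have h3 : H.card • (T + 1) ≤ ∑ a ∈ H, ((Finset.range (4 * (T + 1))).bipartiteAbove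
      (fun a i => IsTrapped G m (s i) a) a).card :=
    Finset.card_nsmul_le_sum _ _ _ fun a ha => (Finset.mem_filter.1 ha).2
  have h4 : ∑ a ∈ H, ((Finset.range (4 * (T + 1))).bipartiteAbove
      (fun a i => IsTrapped G m (s i) a) a).card ≤ ∑ a : V,
      ((Finset.range (4 * (T + 1))).bipartiteAbove (fun a i => IsTrapped G m (s i) a) a).card :=
    Finset.sum_le_sum_of_subset (Finset.subset_univ _)
  rw [Finset.card_range, smul_eq_mul] at h2
  rw [smul_eq_mul] at h3
  have h5 : H.card * (T + 1) ≤ (4 * m) * (T + 1) := by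
    calc H.card * (T + 1) ≤ 4 * (T + 1) * m := by omega
      _ = _ := by ring
  exact Nat.le_of_mul_le_mul_right h5 (Nat.succ_pos T)

/-- A connected graph in which small sets expand by a large factor and any two sets that are
not too small are joined by an edge is Hamiltonian. -/
theorem isHamiltonian_of_isJoined [Fintype V] [DecidableEq V] {G : SimpleGraph V} {m E T : ℕ}
    (hJ : G.IsJoined m)
    (hconn : ∀ X : Finset V, X.Nonempty → X ≠ Finset.univ → ∃ x ∈ X, ∃ y ∉ X, G.Adj x y)
    (hgrow : ∀ S : Finset V, S.card ≤ 4 * m → ∃ N : Finset V, 4 * E * S.card ≤ N.card ∧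
      ∀ w ∈ N, w ∉ S ∧ ∃ x ∈ S, G.Adj x w)
    (hET : 4 * m < E ^ T) (hn : 4 * (T + 1) * (7 * m + 2) + m ≤ Fintype.card V) :
    G.IsHamiltonian := by
  classical
  obtain ⟨l, hl⟩ := exists_isLongestPath G
  have h8 : 8 ≤ 4 * (T + 1) * (7 * m + 2) := by nlinarith
  have hpos : 0 < Fintype.card V := by omega
  obtain ⟨v⟩ := Fintype.card_pos_iff.1 hpos
  have hlen1 := hl.length_le [v] (by simp) (by simp)
  have many : ∀ l : List V, G.IsLongestPath l → l ≠ [] →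
      4 * m < (Finset.univ.filter fun x => x ∈ rotEnds G Set.univ T l).card := by
    intro l hl hne
    rcases hl.pow_le_card_rotEnds hgrow hne T with h | h
    · exact hET.trans_le h
    · exact h
  have hne : l ≠ [] := by rintro rfl; simp at hlen1
  -- Otherwise at least `m` vertices lie off the path, and joinedness sends an edge from one of them
  -- to an available end, extending a longest path.
  have hlen : 4 * (T + 1) * (7 * m + 2) ≤ l.length := by
    by_contra! hlt
    have hc : m ≤ (Finset.univ \ l.toFinset).card := by
      rw [Finset.card_sdiff_of_subset (Finset.subset_univ _), Finset.card_univ,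
        List.toFinset_card_of_nodup hl.nodup]
      omega
    obtain ⟨x, hx, y, hy, hxy⟩ := hJ
      (Finset.univ.filter fun x => x ∈ rotEnds G Set.univ T l) (Finset.univ \ l.toFinset) (by
      rw [Finset.disjoint_left]
      intro w h1 h2
      have := rotEnds_subset w (Finset.mem_filter.1 h1).2
      simp [this] at h2) (by have := many l hl hne; omega) hc
    obtain ⟨l', hl', hx⟩ := (Finset.mem_filter.1 hx).2
    have := hl'.perm.subset ((hl.reach hl').mem_of_adj hx hxy)
    simp [this] at hy
  obtain ⟨s, hs, hd⟩ := exists_blocks hl.nodup hlen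
  have hheavy := card_often_trapped_le hJ (T := T) (s := s) fun i hi =>
    ⟨(hs i hi).2.sublist.nodup hl.nodup, (hs i hi).1.ge⟩
  have pick : ∀ l : List V, G.IsLongestPath l → l ≠ [] → ∃ a l', Reach G Set.univ T l l' ∧
      l'.head? = some a ∧
      ((Finset.range (4 * (T + 1))).filter fun i => IsTrapped G m (s i) a).card ≤ T := by
    intro l hl hne
    obtain ⟨a, ha, ha'⟩ := Finset.exists_mem_notMem_of_card_lt_card
      (hheavy.trans_lt (many l hl hne))
    obtain ⟨l', hl', hx⟩ := (Finset.mem_filter.1 ha).2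
    refine ⟨a, l', hl', hx, ?_⟩
    by_contra! hlt
    exact ha' (Finset.mem_filter.2 ⟨Finset.mem_univ _, hlt⟩)
  obtain ⟨a, l₁, hl₁, ha, hat⟩ := pick l hl hne
  have hl₁' := hl.reach hl₁
  have hne₁ : l₁.reverse ≠ [] := by
    intro h
    rw [List.reverse_eq_nil_iff] at h
    simp [h] at ha
  -- Reversing exposes the other end; these rotations keep `a` as the last vertex.
  obtain ⟨b, l₂, hl₂, hb, hbt⟩ := pick l₁.reverse hl₁'.reverse hne₁
  have hl₂' := hl₁'.reverse.reach hl₂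
  have ha₂ : l₂.getLast? = some a := by rw [hl₂.getLast?, List.getLast?_reverse, ha]
  have u1 := hl₁.card_unbroken_le hd
  have u2 := hl₂.card_unbroken_le hd
  have u0 : ((Finset.range (4 * (T + 1))).filter fun i => Unbroken l (s i)).card
      = 4 * (T + 1) := by
    rw [Finset.filter_true_of_mem, Finset.card_range]
    intro i hi
    exact Or.inl (hs i (Finset.mem_range.1 hi)).2
  have u3 : ((Finset.range (4 * (T + 1))).filter fun i => Unbroken l₁ (s i)).card ≤
      ((Finset.range (4 * (T + 1))).filter fun i => Unbroken l₁.reverse (s i)).card :=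
    Finset.card_le_card (Finset.monotone_filter_right _ fun i _ hi => Unbroken.reverse hi)
  -- Of 4T+4 blocks, at most 2T are broken and at most 2T trap `a` or `b`.
  have hgood : 1 < (((Finset.range (4 * (T + 1))).filter fun i => Unbroken l₂ (s i)) \
      (((Finset.range (4 * (T + 1))).filter fun i => IsTrapped G m (s i) a) ∪
        ((Finset.range (4 * (T + 1))).filter fun i => IsTrapped G m (s i) b))).card := by
    have h1 := Finset.le_card_sdiff
      (((Finset.range (4 * (T + 1))).filter fun i => IsTrapped G m (s i) a) ∪
        ((Finset.range (4 * (T + 1))).filter fun i => IsTrapped G m (s i) b))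
      ((Finset.range (4 * (T + 1))).filter fun i => Unbroken l₂ (s i))
    have h2 := Finset.card_union_le
      ((Finset.range (4 * (T + 1))).filter fun i => IsTrapped G m (s i) a)
      ((Finset.range (4 * (T + 1))).filter fun i => IsTrapped G m (s i) b)
    omega
  have orient : ∀ i < 4 * (T + 1), Unbroken l₂ (s i) → ∃ t, t <:+: l₂ ∧ t ≠ [] ∧
      (∀ x ∈ t, x ∈ s i) ∧ ∀ c, IsTrapped G m t c → IsTrapped G m (s i) c := by
    intro i hi hu
    have hnil : s i ≠ [] := by
      intro h
      have := (hs i hi).1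
      simp [h] at this
    rcases hu with hu | hu
    · exact ⟨s i, hu, hnil, fun x hx => hx, fun c hc => hc⟩
    · exact ⟨(s i).reverse, hu, by simpa using hnil, fun x hx => by simpa using hx,
        fun c hc => hc.reverse⟩
  obtain ⟨i, hi, j, hj, hij⟩ := Finset.one_lt_card.1 hgood
  simp only [Finset.mem_sdiff, Finset.mem_filter, Finset.mem_union, Finset.mem_range,
    not_or, not_and] at hi hj
  obtain ⟨t, ht, htn, hts, htt⟩ := orient i hi.1.1 hi.1.2
  obtain ⟨r, hr, hrn, hrs, hrt⟩ := orient j hj.1.1 hj.1.2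
  have hdis : List.Disjoint t r := fun x h1 h2 =>
    hd i hi.1.1 j hj.1.1 hij (hts x h1) (hrs x h2)
  have finish : ∀ t r : List V, t ≠ [] → r ≠ [] → ¬ IsTrapped G m t b → ¬ IsTrapped G m r a →
      (∃ p q q', l₂ = p ++ t ++ q ++ (r ++ q')) → G.IsHamiltonian := by
    rintro t r h1 h2 h3 h4 ⟨p, q, q', rfl⟩
    obtain ⟨c, x, y, hc, hcc, hx, hy, hyx⟩ :=
      exists_closed_of_not_trapped hJ hl₂'.nodup hl₂'.isChain h1 h2 hb ha₂ h3 h4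
    refine (hl₂'.of_perm hc hcc).isHamiltonian hconn ?_ hx hy hyx
    have e1 := hc.length_eq
    have e2 := hl₂.perm.length_eq
    have e3 := hl₁.perm.length_eq
    rw [List.length_reverse] at e2
    omega
  rcases split_of_two_infix htn hrn hdis ht hr with h | h
  · exact finish t r htn hrn (fun h => hi.2.2 hi.1.1 (htt _ h)) (fun h => hj.2.1 hj.1.1 (hrt _ h)) h
  · exact finish r t hrn htn (fun h => hj.2.2 hj.1.1 (hrt _ h)) (fun h => hi.2.1 hi.1.1 (htt _ h)) h

end SimpleGraph

/-! ### From separations to expansion, and the choice of parameters -/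

namespace SimpleGraph

/-- Apply the hypothesis to (`Yᶜ`, `Xᶜ`): its two differences are `X` and `Y`, and its intersection
is the complement of `X ∪ Y`. -/
theorem IsFunConnected.le_of_no_edges {V : Type*} [Fintype V] [DecidableEq V]
    {G : SimpleGraph V} {f : ℕ → ℝ} (h : G.IsFunConnected f) {X Y : Finset V}
    (hX : X.Nonempty) (hd : Disjoint X Y) (hXY : X.card ≤ Y.card)
    (hno : ∀ x ∈ X, ∀ y ∈ Y, ¬ G.Adj x y) :
    f X.card + X.card + Y.card ≤ Fintype.card V := by
  have hY : Y.Nonempty := Finset.card_pos.1 ((Finset.card_pos.2 hX).trans_le hXY)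
  have e1 : Yᶜ \ Xᶜ = X := by
    ext v
    simp only [Finset.mem_sdiff, Finset.mem_compl, not_not]
    exact ⟨fun h => h.2, fun h => ⟨Finset.disjoint_left.1 hd h, h⟩⟩
  have e2 : Xᶜ \ Yᶜ = Y := by
    ext v
    simp only [Finset.mem_sdiff, Finset.mem_compl, not_not]
    exact ⟨fun h => h.2, fun h => ⟨Finset.disjoint_right.1 hd h, h⟩⟩
  have e3 : Yᶜ ∩ Xᶜ = (X ∪ Y)ᶜ := by rw [Finset.compl_union, Finset.inter_comm]
  have e4 : Yᶜ ∪ Xᶜ = Finset.univ := by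
    rw [← Finset.compl_inter, Finset.inter_comm, Finset.disjoint_iff_inter_eq_empty.1 hd,
      Finset.compl_empty]
  have hsep : G.IsVertexSeparation Yᶜ Xᶜ := by
    refine ⟨?_, ?_, e4, ?_⟩
    · rw [Ne, Finset.compl_eq_univ_iff]; exact hY.ne_empty
    · rw [Ne, Finset.compl_eq_univ_iff]; exact hX.ne_empty
    · rw [e1, e2]; exact hno
  have := h _ _ hsep (by rw [e1, e2]; exact hXY)
  rw [e1, e3] at this
  have hc := Finset.card_compl_add_card (X ∪ Y)
  rw [Finset.card_union_of_disjoint hd] at hc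
  have hc' : ((X ∪ Y)ᶜ.card : ℝ) + (X.card + Y.card) = Fintype.card V := by exact_mod_cast hc
  linarith

/-- Either log k ≥ D, or k ≤ exp D and the constant alone suffices. -/
theorem linear_le_mul_log_add {D k : ℝ} (hD : 0 ≤ D) (hk : 1 ≤ k) :
    D * k ≤ k * Real.log k + D * Real.exp D := by
  rcases le_total D (Real.log k) with h | h
  · have := Real.exp_pos D
    nlinarith
  · have h1 : k ≤ Real.exp D := (Real.log_le_iff_le_exp (by linarith)).1 h
    have h2 := Real.log_nonneg hk
    nlinarith

/-- Parameters for which a graph with superlinear expansion is Hamiltonian. -/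
theorem exists_parameters (E : ℕ) (hE : 200 ≤ Real.log E) : ∃ n₀ : ℕ, ∀ n : ℕ, n₀ ≤ n →
    ∃ m T : ℕ, 1 ≤ m ∧ (n : ℝ) ≤ m * Real.log m ∧ 4 * m * (4 * E + 2) ≤ n ∧ 4 * m < E ^ T ∧
      4 * (T + 1) * (7 * m + 2) + m ≤ n := by
  have hlog : Filter.Tendsto (fun n : ℕ => Real.log n) Filter.atTop Filter.atTop :=
    Real.tendsto_log_atTop.comp tendsto_natCast_atTop_atTop
  have hsq : ∀ᶠ n : ℕ in Filter.atTop, Real.log n ≤ Real.sqrt n := by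
    have h1 := (isLittleO_log_rpow_atTop (r := 1 / 2) (by norm_num)).bound (c := 1) one_pos
    have h2 := tendsto_natCast_atTop_atTop (R := ℝ) |>.eventually h1
    filter_upwards [h2] with n hn
    rw [← Real.sqrt_eq_rpow, one_mul, Real.norm_of_nonneg (Real.sqrt_nonneg _)] at hn
    exact (le_abs_self _).trans hn
  have hev := (hlog.eventually_ge_atTop (16 * (4 * E + 2) + 400)).and hsq
  obtain ⟨n₀, hn₀⟩ := Filter.eventually_atTop.1 hev
  refine ⟨n₀, fun n hn => ?_⟩
  obtain ⟨hL, hs⟩ := hn₀ n hn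
  set L := Real.log n with hLdef
  set r := Real.sqrt n with hr
  have hE0 : (0 : ℝ) ≤ E := Nat.cast_nonneg E
  have hL400 : 400 ≤ L := by linarith
  have hrr : r * r = n := Real.mul_self_sqrt (Nat.cast_nonneg n)
  have hr400 : 400 ≤ r := hL400.trans hs
  have hnpos : (0 : ℝ) < n := by nlinarith
  have hEpos : (0 : ℝ) < E := by
    rcases hE0.lt_or_eq with h | h
    · exact h
    · rw [← h] at hE; norm_num at hE
  have hLpos : 0 < L := by linarith
  have hLn : 20 * L ≤ n := by nlinarith
  have hq : 2 * (n : ℝ) / L * L = 2 * n := div_mul_cancel₀ _ hLpos.ne'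
  -- With m ≥ 2n / log n ≥ √n, log m is at least half of log n, whence m log m ≥ n.
  set q := 2 * (n : ℝ) / L with hqdef
  have hqpos : 0 < q := by positivity
  have hqr : r ≤ q := by
    rw [hqdef, le_div_iff₀ hLpos]
    nlinarith
  have hm1 : q ≤ (⌈q⌉₊ : ℝ) := Nat.le_ceil q
  have hm2 : (⌈q⌉₊ : ℝ) < q + 1 := Nat.ceil_lt_add_one hqpos.le
  set m := ⌈q⌉₊ with hm
  set t := L / Real.log E with ht
  have ht0 : 0 ≤ t := by positivity
  have ht1 : t ≤ (⌈t⌉₊ : ℝ) := Nat.le_ceil t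
  have ht2 : (⌈t⌉₊ : ℝ) < t + 1 := Nat.ceil_lt_add_one ht0
  set T := ⌈t⌉₊ with hT
  have htL : 200 * t ≤ L := by
    have : t * Real.log E = L := div_mul_cancel₀ _ (by linarith)
    nlinarith
  have hmpos : 1 ≤ m := Nat.ceil_pos.2 hqpos
  have h2 : 4 * (m : ℝ) * (4 * E + 2) ≤ n := by
    have h16 : q * (16 * (4 * E + 2)) ≤ 2 * n := by
      rw [← hq]
      exact mul_le_mul_of_nonneg_left (by linarith) hqpos.le
    nlinarith
  have h2' : 4 * m * (4 * E + 2) ≤ n := by exact_mod_cast h2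
  refine ⟨m, T, hmpos, ?_, h2', ?_, ?_⟩
  · have hlr : Real.log r = L / 2 := by rw [hr, Real.log_sqrt (Nat.cast_nonneg n)]
    have hlm : L / 2 ≤ Real.log m := by
      rw [← hlr]
      exact Real.log_le_log (by linarith) (hqr.trans hm1)
    have : q * (L / 2) ≤ m * Real.log m := mul_le_mul hm1 hlm (by positivity) (by positivity)
    linarith
  · have h3 : n ≤ E ^ T := by
      have : (n : ℝ) ≤ (E : ℝ) ^ T := by
        rw [← Real.log_le_log_iff hnpos (by positivity), Real.log_pow]
        rw [ht, div_le_iff₀ (by linarith)] at ht1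
        exact ht1
      exact_mod_cast this
    nlinarith
  -- The blocks use about 4 · 7 · (2n / log n) · (log n / log `E`) = 56n / log `E` vertices; log `E`
  -- ≥ 200 leaves ample room.
  · have h400 : 400 * q ≤ 2 * n := by
      rw [← hq]
      nlinarith
    have hTL : 200 * ((T : ℝ) + 1) ≤ L + 400 := by linarith
    have h7 : 7 * (m : ℝ) + 2 ≤ 7 * q + 9 := by linarith
    have hprod : 200 * ((T : ℝ) + 1) * (7 * m + 2) ≤ (L + 400) * (7 * q + 9) :=
      mul_le_mul hTL h7 (by positivity) (by positivity)
    have hexp : (L + 400) * (7 * q + 9) = 14 * n + 9 * L + 2800 * q + 3600 := by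
      linear_combination 7 * hq
    have hn3 : 160000 ≤ (n : ℝ) := by nlinarith
    have : 4 * ((T : ℝ) + 1) * (7 * m + 2) + m ≤ n := by
      have e : 4 * ((T : ℝ) + 1) * (7 * m + 2) = (200 * ((T : ℝ) + 1) * (7 * m + 2)) / 50 := by
        ring
      rw [e]
      linarith
    exact_mod_cast this

theorem IsFunConnected.isHamiltonian {V : Type*} [Fintype V] [DecidableEq V]
    {G : SimpleGraph V} {f : ℕ → ℝ} {C : ℝ} {E m T : ℕ} (h : G.IsFunConnected f)
    (hf : ∀ k : ℕ, 1 ≤ k → (k : ℝ) * Real.log (k : ℝ) + C ≤ f k) (hC0 : 0 < C)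
    (hC : ∀ k : ℕ, 1 ≤ k → 4 * E * (k : ℝ) ≤ k * Real.log k + C) (hm : 1 ≤ m)
    (h1 : (Fintype.card V : ℝ) ≤ m * Real.log m) (h2 : 4 * m * (4 * E + 2) ≤ Fintype.card V)
    (h3 : 4 * m < E ^ T) (h4 : 4 * (T + 1) * (7 * m + 2) + m ≤ Fintype.card V) :
    G.IsHamiltonian := by
  have hnn : ∀ k : ℕ, 0 ≤ (k : ℝ) * Real.log k := fun k =>
    mul_nonneg (Nat.cast_nonneg k) (Real.log_natCast_nonneg k)
  have base : ∀ X Y : Finset V, X.Nonempty → Disjoint X Y → X.card ≤ Y.card →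
      (∀ x ∈ X, ∀ y ∈ Y, ¬ G.Adj x y) →
      (X.card : ℝ) * Real.log X.card + C + X.card + Y.card ≤ Fintype.card V := by
    intro X Y hX hd hXY hno
    have := h.le_of_no_edges hX hd hXY hno
    have := hf X.card (Finset.card_pos.2 hX)
    linarith
  refine isHamiltonian_of_isJoined (m := m) (E := E) (T := T) ?_ ?_ ?_ h3 h4
  · have key : ∀ X Y : Finset V, Disjoint X Y → m ≤ X.card → X.card ≤ Y.card →
        (∀ x ∈ X, ∀ y ∈ Y, ¬ G.Adj x y) → False := by
      intro X Y hd hX hXY hno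
      have hb := base X Y (Finset.card_pos.1 (by omega)) hd hXY hno
      have hmX : (m : ℝ) ≤ X.card := by exact_mod_cast hX
      have hm1 : (1 : ℝ) ≤ m := by exact_mod_cast hm
      have hl := Real.log_le_log (by linarith) hmX
      have : (m : ℝ) * Real.log m ≤ X.card * Real.log X.card :=
        mul_le_mul hmX hl (Real.log_nonneg hm1) (by positivity)
      have h0 : (0 : ℝ) ≤ Y.card := Nat.cast_nonneg _
      linarith
    intro X Y hd hX hY
    by_contra! hno
    rcases le_total X.card Y.card with hle | hle
    · exact key X Y hd hX hle hno
    · exact key Y X hd.symm hY hle fun y hy x hx hyx => hno x hx y hy hyx.symm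
  · intro X hX hXu
    by_contra! hno
    have hXc : Xᶜ.Nonempty := by
      rw [Finset.nonempty_iff_ne_empty, Ne, Finset.compl_eq_empty_iff]; exact hXu
    have hcard : (X.card : ℝ) + Xᶜ.card = Fintype.card V := by
      exact_mod_cast Finset.card_add_card_compl X
    rcases le_total X.card Xᶜ.card with hle | hle
    · have := base X Xᶜ hX disjoint_compl_right hle
        fun x hx y hy => hno x hx y (Finset.mem_compl.1 hy)
      have := hnn X.card
      linarith
    · have := base Xᶜ X hXc disjoint_compl_left hle
        fun y hy x hx hyx => hno x hx y (Finset.mem_compl.1 hy) hyx.symm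
      have := hnn Xᶜ.card
      linarith
  · classical
    intro S hS
    rcases S.eq_empty_or_nonempty with rfl | hne
    · exact ⟨∅, by simp, by simp⟩
    set N := Finset.univ.filter fun w => w ∉ S ∧ ∃ x ∈ S, G.Adj x w with hN
    refine ⟨N, ?_, fun w hw => (Finset.mem_filter.1 hw).2⟩
    have hSN : Disjoint S N := Finset.disjoint_left.2 fun w h1 h2 =>
      (Finset.mem_filter.1 h2).2.1 h1
    have hcard := Finset.card_add_card_compl (S ∪ N)
    rw [Finset.card_union_of_disjoint hSN] at hcard
    -- If the remainder is smaller than `S`, then |N| > n − 2|S| ≥ 4E|S| by the size of n. Otherwise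
    -- `N` separates `S` from it, and the separation bound applies.
    rcases lt_or_ge (S ∪ N)ᶜ.card S.card with hlt | hge
    · have : S.card * (4 * E + 2) ≤ 4 * m * (4 * E + 2) := Nat.mul_le_mul_right _ hS
      nlinarith
    · have hb := base S (S ∪ N)ᶜ hne
        (Finset.disjoint_left.2 fun w h1 h2 => Finset.mem_compl.1 h2 (Finset.mem_union_left _ h1))
        hge fun x hx y hy hxy => by
          rw [Finset.mem_compl, Finset.mem_union, not_or] at hy
          exact hy.2 (Finset.mem_filter.2 ⟨Finset.mem_univ _, hy.1, x, hx, hxy⟩)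
      have hc := hC S.card (Finset.card_pos.2 hne)
      have hcard' : (S.card : ℝ) + N.card + (S ∪ N)ᶜ.card = Fintype.card V := by
        exact_mod_cast hcard
      have : (4 : ℝ) * E * S.card ≤ N.card := by linarith
      exact_mod_cast this

end SimpleGraph

theorem theorem6 :
    ∃ C : ℝ, ∃ n₀ : ℕ, ∀ f : ℕ → ℝ,
      (∀ k : ℕ, 1 ≤ k → (k : ℝ) * Real.log (k : ℝ) + C ≤ f k) →
        ∀ (V : Type*) [Fintype V] [DecidableEq V] (G : SimpleGraph V),
          n₀ ≤ Fintype.card V → G.IsFunConnected f → G.IsHamiltonian := by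
  obtain ⟨E, hE⟩ := exists_nat_ge (Real.exp 200)
  have hEpos : (0 : ℝ) < E := (Real.exp_pos _).trans_le hE
  obtain ⟨n₀, hn₀⟩ := SimpleGraph.exists_parameters E ((Real.le_log_iff_exp_le hEpos).2 hE)
  -- This constant lifts k log k above the line 4Ek for every k ≥ 1.
  refine ⟨4 * E * Real.exp (4 * E), n₀, fun f hf V _ _ G hn hG => ?_⟩
  obtain ⟨m, T, hm, h1, h2, h3, h4⟩ := hn₀ _ hn
  exact hG.isHamiltonian hf (by positivity) (fun k hk =>
    SimpleGraph.linear_le_mul_log_add (by positivity) (by exact_mod_cast hk)) hm h1 h2 h3 h4
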